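/- All Banach spaces are over $\mathbb{C}$; $E'$ denotes the dual of $E$, $B_E$ its closed unit ball, and $E$ is regarded as a subspace of $E''$. A linear projection $P$ on a Banach space $E$ is an L-projection if $\|x\|=\|Px\|+\|x-Px\|$ for all $x\in E$. A Banach space $X$ is L-embedded if $X$ is the range of an L-projection on $X''$; a Banach space $Z$ is M-embedded if $Z$ is an M-ideal in $Z''$, i.e. if the annihilator $Z^{\perp}\subset Z'''$ of $Z$ is the range of an L-projection on $Z'''$. A sequence $(x_n)$ of nonzero elements of a Banach space spans $\ell^1$ asymptotically if there is a sequence $(\delta_n)$ in $[0,1)$ tending to $0$ such that $\sum_n(1-\delta_n)|\alpha_n|\le\bigl\|\sum_n\alpha_n\frac{x_n}{\|x_n\|}\bigr\|\le\sum_n|\alpha_n|$ for all finitely supported families of scalars $(\alpha_n)$. A topology $\tau$ on a Banach space $X$ is an abstract measure topology if: 1. $(X,\tau)$ is a sequential space (sequentially closed sets are closed) in which every convergent sequence has a unique limit; 2. $\tau$ is weaker than (or equal to) the norm topology; 3. for all sequences $(x_n)$ and all $x$ in $X$, $x_n\to x$ in $\tau$ if and only if $x_n-x\to0$ in $\tau$;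 4. each bounded sequence that spans $\ell^1$ asymptotically $\tau$-converges to $0$, and each sequence that $\tau$-converges to $0$ is bounded and has a subsequence which spans $\ell^1$ asymptotically or tends to $0$ in norm. **Theorem.** Let $X$ be an L-embedded Banach space. Then $X$ admits exactly one abstract measure topology, denoted $\tau_\mu$. Put $$X^{\#}=\{x'\in X' : x'|_{B_X}\text{ is }\tau_\mu\text{-continuous}\}.$$ The following assertions are equivalent: (i) $X$ is isometrically isomorphic to the dual $Z'$ of an M-embedded Banach space $Z$; (ii) $X^{\#}$ separates the points of $X$. If (i) and (ii) are satisfied, then every $Z$ as in (i) is isometrically isomorphic to $X^{\#}$. -/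

import Mathlib

open Filter Topology

universe u v


/-- The dual Banach space `E'`. -/
abbrev BDual (E : Type u) [NormedAddCommGroup E] [NormedSpace ℂ E] : Type u :=
  StrongDual ℂ E

/-- The canonical image of `E` in its bidual `E''`. -/
noncomputable def canonicalImage (E : Type u) [NormedAddCommGroup E] [NormedSpace ℂ E] :
    Submodule ℂ (BDual (BDual E)) :=
  (NormedSpace.inclusionInDoubleDual ℂ E).range

/-- The annihilator of a subspace `Y` of `E` in the dual `E'`. -/
def annihilatorInDual {E : Type u} [NormedAddCommGroup E] [NormedSpace ℂ E]
    (Y : Submodule ℂ E) : Submodule ℂ (BDual E) where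
  carrier := {f | ∀ y ∈ Y, f y = 0}
  add_mem' := by
    intro f g hf hg y hy
    simp [hf y hy, hg y hy]
  zero_mem' := by
    intro y _
    simp
  smul_mem' := by
    intro c f hf y hy
    simp [hf y hy]

/-- `Y` is an L-summand in `E`: it is the range of an L-projection on `E`, that is, of a linear
projection `P` with `‖x‖ = ‖P x‖ + ‖x - P x‖` for all `x`. -/
def IsLSummand {E : Type u} [NormedAddCommGroup E] [NormedSpace ℂ E]
    (Y : Submodule ℂ E) : Prop :=
  ∃ P : E →L[ℂ] E, IsLprojection E P ∧ P.range = Y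

/-- `Y` is an M-ideal in `E`: its annihilator in `E'` is the range of an L-projection on `E'`. -/
def IsMIdeal {E : Type u} [NormedAddCommGroup E] [NormedSpace ℂ E]
    (Y : Submodule ℂ E) : Prop :=
  IsLSummand (annihilatorInDual Y)

/-- `E` is L-embedded: it is an L-summand in its bidual. -/
def LEmbedded (E : Type u) [NormedAddCommGroup E] [NormedSpace ℂ E] : Prop :=
  IsLSummand (canonicalImage E)

/-- `E` is M-embedded: it is an M-ideal in its bidual. -/
def MEmbedded (E : Type u) [NormedAddCommGroup E] [NormedSpace ℂ E] : Prop :=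
  IsMIdeal (canonicalImage E)

/-- A sequence `(x n)` of nonzero vectors spans `ℓ¹` asymptotically (isometrically). The
inequalities are required for all finite systems of scalars, which for vectors of a Banach space
is the same as for all absolutely summable sequences of scalars. -/
def SpansL1Asymptotically {E : Type u} [NormedAddCommGroup E] [NormedSpace ℂ E]
    (x : ℕ → E) : Prop :=
  (∀ n, x n ≠ 0) ∧
  ∃ δ : ℕ → ℝ, (∀ n, 0 ≤ δ n ∧ δ n < 1) ∧ Tendsto δ atTop (𝓝 0) ∧
    ∀ (s : Finset ℕ) (α : ℕ → ℂ),
      ∑ n ∈ s, (1 - δ n) * ‖α n‖ ≤ ‖∑ n ∈ s, α n • ((‖x n‖⁻¹ : ℝ) : ℂ) • x n‖ ∧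
      ‖∑ n ∈ s, α n • ((‖x n‖⁻¹ : ℝ) : ℂ) • x n‖ ≤ ∑ n ∈ s, ‖α n‖

/-- The sequence `x` converges to `a` with respect to the topology `τ`. -/
def TauTendsto {E : Type u} (τ : TopologicalSpace E) (x : ℕ → E) (a : E) : Prop :=
  Tendsto x atTop (@nhds E τ a)

/-- `τ` is an abstract measure topology on the normed space `E`. -/
structure IsAbstractMeasureTopology (E : Type u) [NormedAddCommGroup E] [NormedSpace ℂ E]
    (τ : TopologicalSpace E) : Prop where
  /-- closed sets and sequentially closed sets coincide -/
  sequential : @SequentialSpace E τ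
  /-- every convergent sequence has a unique limit -/
  unique_limit : ∀ (x : ℕ → E) (a b : E), TauTendsto τ x a → TauTendsto τ x b → a = b
  /-- `τ` is weaker than the norm topology: every `τ`-open set is norm open -/
  weaker : ∀ U : Set E, @IsOpen E τ U →
    @IsOpen E (PseudoMetricSpace.toUniformSpace.toTopologicalSpace) U
  /-- `τ` is translation invariant for sequences -/
  translation : ∀ (x : ℕ → E) (a : E),
    TauTendsto τ x a ↔ TauTendsto τ (fun n => x n - a) 0
  /-- bounded sequences spanning `ℓ¹` asymptotically are `τ`-null -/
  null_of_spans : ∀ x : ℕ → E, (∃ C : ℝ, ∀ n, ‖x n‖ ≤ C) → SpansL1Asymptotically x →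
    TauTendsto τ x 0
  /-- `τ`-null sequences are bounded -/
  bounded_of_null : ∀ x : ℕ → E, TauTendsto τ x 0 → ∃ C : ℝ, ∀ n, ‖x n‖ ≤ C
  /-- a `τ`-null sequence has a subsequence that spans `ℓ¹` asymptotically or is norm null -/
  subseq_of_null : ∀ x : ℕ → E, TauTendsto τ x 0 → ∃ φ : ℕ → ℕ, StrictMono φ ∧
    (SpansL1Asymptotically (x ∘ φ) ∨ Tendsto (fun n => ‖x (φ n)‖) atTop (𝓝 0))

/-- The space of all `f` in the dual `E'` whose restriction to the closed unit ball of `E`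
is `τ`-continuous, with the norm of `E'`. -/
def sharpSpace (E : Type u) [NormedAddCommGroup E] [NormedSpace ℂ E]
    (τ : TopologicalSpace E) : Submodule ℂ (BDual E) where
  carrier := {f | @ContinuousOn E ℂ τ _ (fun x => f x) (Metric.closedBall (0 : E) 1)}
  add_mem' := by
    intro f g hf hg
    exact @ContinuousOn.add ℂ _ _ _ E τ _ _ _ hf hg
  zero_mem' := @continuousOn_const E ℂ τ _ _ _
  smul_mem' := by
    intro c f hf
    exact ContinuousOn.const_smul hf c

/-! Write X'' = X ⊕₁ S. The proof relates S to asymptotic ℓ¹-sequences in both directions. Weak*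
limits of normalized asymptotic ℓ¹-sequences along free ultrafilters lie in S
(`IsSingularPart.limit_mem`). Conversely, by Goldstine's theorem and compactness, a norm-one s in S
yields an asymptotic ℓ¹-sequence in the ball of X on which |f| stays above any prescribed number
below |s(f)| (`IsSingularPart.exists_spansL1Asymptotically`).

Since X ∩ S = 0, the first fact makes limits for `MeasureConv` unique, and the sequential topology
of this convergence is an abstract measure topology. The axioms determine the convergent sequences,
and a sequential topology is determined by those, whence uniqueness. Both facts together identify
X^# with the functionals killed by S (`IsAbstractMeasureTopology.mem_sharpSpace_iff`).

A predual Z, embedded in X', is M-embedded exactly when its annihilator in X'' is an ℓ¹-complement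
of X. The description of X^# may then be applied with this annihilator as S, and Hahn-Banach gives Z
= X^#, which separates points. Conversely, if X^# separates points, the decomposition of X'' makes X
the dual of X^#, and the annihilator of X^# is S itself. -/

/-! ### Topologies generated by sequential convergence -/

/-- An abstract sequential convergence with unique limits, satisfying Urysohn's axiom. -/
structure IsSeqConvergence {A : Type u} (Conv : (ℕ → A) → A → Prop) : Prop where
  const : ∀ a, Conv (fun _ => a) a
  subseq : ∀ {x a} {φ : ℕ → ℕ}, Conv x a → StrictMono φ → Conv (x ∘ φ) a
  urysohn : ∀ {x a}, (∀ φ : ℕ → ℕ, StrictMono φ → ∃ ψ : ℕ → ℕ, StrictMono ψ ∧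
    Conv (x ∘ φ ∘ ψ) a) → Conv x a
  unique : ∀ {x a b}, Conv x a → Conv x b → a = b

/-- The topology whose open sets are the sequentially open ones. -/
@[reducible]
def seqTopology {A : Type u} (Conv : (ℕ → A) → A → Prop) : TopologicalSpace A where
  IsOpen U := ∀ x a, Conv x a → a ∈ U → ∀ᶠ n in atTop, x n ∈ U
  isOpen_univ := by simp
  isOpen_inter U V hU hV x a h ha := (hU x a h ha.1).and (hV x a h ha.2)
  isOpen_sUnion s hs x a h := by
    rintro ⟨U, hU, ha⟩
    exact (hs U hU x a h ha).mono fun n hn => ⟨U, hU, hn⟩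

theorem TauTendsto.comp_strictMono {A : Type u} {τ : TopologicalSpace A} {x : ℕ → A} {a : A}
    (h : TauTendsto τ x a) {φ : ℕ → ℕ} (hφ : StrictMono φ) : TauTendsto τ (x ∘ φ) a :=
  Tendsto.comp h hφ.tendsto_atTop

theorem tauTendsto_iff_isOpen {A : Type u} {τ : TopologicalSpace A} {x : ℕ → A} {a : A} :
    TauTendsto τ x a ↔ ∀ U, IsOpen[τ] U → a ∈ U → ∀ᶠ n in atTop, x n ∈ U := by
  let := τ
  refine tendsto_nhds.trans (forall_congr' fun U => ?_)
  rfl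

theorem tauTendsto_seqTopology_of_conv {A : Type u} {Conv : (ℕ → A) → A → Prop} {x : ℕ → A}
    {a : A} (h : Conv x a) : TauTendsto (seqTopology Conv) x a :=
  tauTendsto_iff_isOpen.2 fun _ hU ha => hU x a h ha

theorem sequentialSpace_seqTopology {A : Type u} (Conv : (ℕ → A) → A → Prop)
    (hc : IsSeqConvergence Conv) :
    @SequentialSpace A (seqTopology Conv) := by
  let := seqTopology Conv
  refine ⟨fun s hs => ?_⟩
  rw [← isOpen_compl_iff]
  intro x a h ha
  by_contra hne
  obtain ⟨φ, hφ, hx⟩ := extraction_of_frequently_atTop hne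
  exact ha (hs (fun n => by simpa using hx n) (tauTendsto_seqTopology_of_conv (hc.subseq h hφ)))

/-- Either some value is taken infinitely often or k tends to infinity. -/
theorem exists_strictMono_const_or_strictMono_comp (k : ℕ → ℕ) :
    ∃ θ : ℕ → ℕ, StrictMono θ ∧ ((∃ m, ∀ n, k (θ n) = m) ∨ StrictMono (k ∘ θ)) := by
  by_cases h : ∃ m, ∃ᶠ n in atTop, k n = m
  · obtain ⟨m, hm⟩ := h
    obtain ⟨θ, hθ, h⟩ := extraction_of_frequently_atTop hm
    exact ⟨θ, hθ, Or.inl ⟨m, h⟩⟩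
  · have hk : Tendsto k atTop atTop := by
      rw [← Nat.cofinite_eq_atTop]
      refine Filter.Tendsto.cofinite_of_finite_preimage_singleton fun m => ?_
      push Not at h
      have := h m
      rw [← Nat.cofinite_eq_atTop, eventually_cofinite] at this
      simpa [Set.preimage] using this.to_subtype
    obtain ⟨θ, hθ, h⟩ := strictMono_subseq_of_tendsto_atTop hk
    exact ⟨θ, hθ, Or.inr h⟩

namespace IsSeqConvergence

variable {A : Type u} {Conv : (ℕ → A) → A → Prop}

theorem eq_of_frequently_eq (hc : IsSeqConvergence Conv) {x : ℕ → A} {a b : A} (h : Conv x a)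
    (hb : ∃ᶠ n in atTop, x n = b) : a = b := by
  obtain ⟨φ, hφ, hx⟩ := extraction_of_frequently_atTop hb
  have h1 := hc.subseq h hφ
  rw [show x ∘ φ = fun _ => b from funext hx] at h1
  exact hc.unique h1 (hc.const b)

/-- If all convergent subsequences of `z` converge to `b`, then `{b} ∪ range z` is closed. -/
theorem isOpen_compl_insert_range (hc : IsSeqConvergence Conv) {z : ℕ → A} {b : A}
    (hz : ∀ θ : ℕ → ℕ, StrictMono θ → ∀ c, Conv (z ∘ θ) c → c = b) :
    IsOpen[seqTopology Conv] (insert b (Set.range z))ᶜ := by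
  intro w c hwc hcC
  by_contra hne
  have hne : ∃ᶠ n in atTop, w n = b ∨ w n ∈ Set.range z := by
    refine Frequently.mono hne fun n hn => ?_
    simpa [eq_comm] using hn
  apply hcC
  rcases frequently_or_distrib.1 hne with h | h
  · exact Or.inl (hc.eq_of_frequently_eq hwc h)
  · obtain ⟨φ, hφ, hx⟩ := extraction_of_frequently_atTop h
    choose k hk using hx
    -- If an index of z recurs infinitely often, c is that term of z; otherwise w and z have a
    -- common subsequence, and the hypothesis on z applies.
    obtain ⟨θ, hθ, ⟨m, hm⟩ | hmono⟩ := exists_strictMono_const_or_strictMono_comp k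
    · refine Or.inr ⟨m, (hc.eq_of_frequently_eq (hc.subseq hwc (hφ.comp hθ)) ?_).symm⟩
      exact Frequently.of_forall fun n => by simp [← hk, hm]
    · have h1 := hc.subseq hwc (hφ.comp hθ)
      rw [show w ∘ φ ∘ θ = z ∘ (k ∘ θ) from funext fun n => (hk _).symm] at h1
      exact Or.inl (hz _ hmono _ h1)

/-- By Urysohn's axiom, failure of `Conv` gives a subsequence none of whose subsequences converges
to a. It suffices to enclose a subsequence of it in a closed set {b} ∪ range that misses a: take b
to be the limit of a convergent subsequence if there is one, and otherwise any term different from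
a. Dropping finitely many terms keeps a out of the range. -/
theorem tauTendsto_iff (hc : IsSeqConvergence Conv) {x : ℕ → A} {a : A} :
    TauTendsto (seqTopology Conv) x a ↔ Conv x a := by
  refine ⟨fun hx => hc.urysohn fun φ hφ => ?_, tauTendsto_seqTopology_of_conv⟩
  by_contra! hno
  have hy : ∀ᶠ n in atTop, x (φ n) ≠ a := by
    by_contra hne
    obtain ⟨ψ, hψ, h⟩ := extraction_of_frequently_atTop hne
    refine hno ψ hψ ?_
    rw [show x ∘ φ ∘ ψ = fun _ => a from funext fun n => by simpa using h n]
    exact hc.const a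
  have key : ∀ (θ : ℕ → ℕ) (b : A), StrictMono θ → b ≠ a →
      ¬ ∀ ξ : ℕ → ℕ, StrictMono ξ → ∀ c, Conv (x ∘ φ ∘ θ ∘ ξ) c → c = b := by
    intro θ b hθ hb hall
    obtain ⟨N, hN⟩ := eventually_atTop.1 hy
    have hs : StrictMono fun n => θ (n + N) := fun i j h => hθ (by omega)
    have hopen := hc.isOpen_compl_insert_range (z := fun n => x (φ (θ (n + N)))) (b := b)
      fun ξ hξ c h => hall (fun n => ξ n + N) (fun i j h => by have := hξ h; simp; omega) c h
    have ha : a ∈ (insert b (Set.range fun n => x (φ (θ (n + N)))))ᶜ := by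
      simp only [Set.mem_compl_iff, Set.mem_insert_iff, Set.mem_range, not_or, not_exists]
      exact ⟨hb.symm, fun n => hN _ ((Nat.le_add_left N n).trans hθ.le_apply)⟩
    obtain ⟨n, hn⟩ := (tauTendsto_iff_isOpen.1 (hx.comp_strictMono (hφ.comp hs)) _ hopen ha).exists
    exact hn (Or.inr ⟨n, rfl⟩)
  by_cases h : ∃ θ : ℕ → ℕ, StrictMono θ ∧ ∃ b, Conv (x ∘ φ ∘ θ) b
  · obtain ⟨θ, hθ, b, hb⟩ := h
    refine key θ b hθ ?_ fun ξ hξ c hconv => hc.unique hconv (hc.subseq (x := x ∘ φ ∘ θ) hb hξ)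
    rintro rfl
    exact hno θ hθ hb
  · push Not at h
    obtain ⟨n, hn⟩ := hy.exists
    exact key id (x (φ n)) strictMono_id hn fun ξ hξ c hconv => (h ξ hξ c hconv).elim

end IsSeqConvergence

theorem eq_of_tauTendsto_iff {A : Type u} {τ σ : TopologicalSpace A} (hτ : @SequentialSpace A τ)
    (hσ : @SequentialSpace A σ) (h : ∀ x a, TauTendsto τ x a ↔ TauTendsto σ x a) : τ = σ := by
  have key : ∀ {τ σ : TopologicalSpace A}, @SequentialSpace A τ →
      (∀ x a, TauTendsto τ x a → TauTendsto σ x a) → ∀ s, IsClosed[σ] s → IsClosed[τ] s := by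
    intro τ σ hτ h s hs
    refine @IsSeqClosed.isClosed A τ hτ s fun x a hx hxa => ?_
    exact @IsClosed.mem_of_tendsto A σ ℕ _ _ _ _ _ hs (h x a hxa) (Eventually.of_forall hx)
  refine TopologicalSpace.ext_iff_isClosed.2 fun s =>
    ⟨key hσ (fun x a => (h x a).2) s, key hτ (fun x a => (h x a).1) s⟩

/-! ### Functionals -/

section Functionals

variable {E : Type u} [NormedAddCommGroup E] [NormedSpace ℂ E]

/-- Helly's condition: a functional `g` dominated by `‖L ·‖` factors through `L` as a functional
of norm at most `1`. -/
theorem exists_dual_of_norm_le {V : Type v} [AddCommGroup V] [Module ℂ V] (L : V →ₗ[ℂ] E)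
    (g : V →ₗ[ℂ] ℂ) (h : ∀ v, ‖g v‖ ≤ ‖L v‖) :
    ∃ f : BDual E, ‖f‖ ≤ 1 ∧ ∀ v, f (L v) = g v := by
  have hg : g ∈ L.dualMap.range := by
    rw [LinearMap.range_dualMap_eq_dualAnnihilator_ker, Submodule.mem_dualAnnihilator]
    intro v hv
    have := h v
    rw [LinearMap.mem_ker.1 hv, norm_zero] at this
    exact norm_le_zero_iff.1 this
  obtain ⟨k, hk⟩ := hg
  have hk' : ∀ v, k (L v) = g v := fun v => by rw [← hk]; rfl
  let f₀ : StrongDual ℂ L.range := (k.comp L.range.subtype).mkContinuous 1 (by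
    rintro ⟨_, v, rfl⟩
    simpa [hk'] using h v)
  obtain ⟨f, hf, hn⟩ := exists_extension_norm_eq L.range f₀
  refine ⟨f, hn ▸ LinearMap.mkContinuous_norm_le _ zero_le_one _, fun v => ?_⟩
  rw [← hk' v]
  exact hf ⟨L v, v, rfl⟩

theorem exists_dual_eq_zero_of_notMem {Y : Submodule ℂ E} (hY : IsClosed (Y : Set E)) {x : E}
    (hx : x ∉ Y) : ∃ f : BDual E, (∀ y ∈ Y, f y = 0) ∧ f x ≠ 0 := by
  obtain ⟨f, u, hlt, hu⟩ := RCLike.geometric_hahn_banach_closed_point (𝕜 := ℂ)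
    (Y.restrictScalars ℝ).convex hY hx
  have h0 : ∀ y ∈ Y, f y = 0 := by
    intro y hy
    by_contra hne
    -- At this multiple of y the functional takes the value u, but on Y its real part is below u.
    have := hlt ((u : ℂ) • (f y)⁻¹ • y) (Y.smul_mem _ (Y.smul_mem _ hy))
    simp [hne] at this
  refine ⟨f, h0, fun hfx => ?_⟩
  have := hlt 0 Y.zero_mem
  rw [hfx] at hu
  simp at hu this
  linarith

/-- Goldstine's theorem. -/
theorem exists_norm_le_one_forall_norm_sub_lt (s : BDual (BDual E)) (hs : ‖s‖ ≤ 1)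
    (G : Finset (BDual E)) {ε : ℝ} (hε : 0 < ε) :
    ∃ x : E, ‖x‖ ≤ 1 ∧ ∀ g ∈ G, ‖g x - s g‖ < ε := by
  classical
  let T : E →ₗ[ℂ] (G → ℂ) := LinearMap.pi fun g => (g : BDual E).toLinearMap
  let p : G → ℂ := fun g => s g
  have hconv : Convex ℝ (T '' Metric.closedBall 0 1) :=
    (convex_closedBall (0 : E) 1).linear_image (T.restrictScalars ℝ)
  have hp : p ∈ closure (T '' Metric.closedBall 0 1) := by
    by_contra hp
    obtain ⟨f, c, hlt, hc⟩ := RCLike.geometric_hahn_banach_closed_point (𝕜 := ℂ)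
      hconv.closure isClosed_closure hp
    let h : BDual E := ∑ g : G, f (Pi.single g 1) • (g : BDual E)
    have hfT : ∀ q : G → ℂ, f q = ∑ g : G, f (Pi.single g 1) * q g := by
      intro q
      conv_lhs => rw [pi_eq_sum_univ' q]
      rw [map_sum]
      refine Finset.sum_congr rfl fun g _ => ?_
      rw [map_smul, smul_eq_mul, mul_comm]
    have hfh : ∀ x, f (T x) = h x := by
      intro x
      rw [hfT]
      simp [h, T]
    have hsh : f p = s h := by
      rw [hfT]
      simp [h, p]
    have hre : ∀ x : E, ‖x‖ ≤ 1 → (h x).re < c := by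
      intro x hx
      rw [← hfh]
      exact hlt _ (subset_closure ⟨x, by simpa using hx, rfl⟩)
    have hc0 : 0 < c := by simpa using hre 0 (by simp)
    have hnorm : ‖h‖ ≤ c := by
      refine ContinuousLinearMap.opNorm_le_of_unit_norm hc0.le fun x hx => ?_
      -- Rotating x turns the bound on the real part into a bound on the modulus.
      obtain ⟨w, hw, hwx⟩ := RCLike.exists_norm_eq_mul_self (h x)
      have h1 := hre (w • x) (by rw [norm_smul, hw, hx, one_mul])
      rw [map_smul, smul_eq_mul, ← hwx] at h1
      simpa using h1.le
    have h2 : (s h).re ≤ ‖h‖ := (Complex.re_le_norm _).trans <|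
      (s.le_opNorm h).trans (mul_le_of_le_one_left (norm_nonneg _) hs)
    rw [hsh] at hc
    exact absurd (hc.trans_le (h2.trans hnorm)) (lt_irrefl _)
  obtain ⟨_, ⟨x, hx, rfl⟩, hxp⟩ := Metric.mem_closure_iff.1 hp ε hε
  refine ⟨x, by simpa using hx, fun g hg => ?_⟩
  have := (dist_le_pi_dist p (T x) ⟨g, hg⟩).trans_lt hxp
  rwa [dist_comm, dist_eq_norm] at this

/-- Weak* compactness of balls of the bidual, along an ultrafilter. -/
theorem exists_weakStar_limit {ι : Type v} (U : Ultrafilter ι) (x : ι → E) {C : ℝ}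
    (hx : ∀ i, ‖x i‖ ≤ C) :
    ∃ p : BDual (BDual E), ‖p‖ ≤ C ∧ ∀ f : BDual E, Tendsto (fun i => f (x i)) U (𝓝 (p f)) := by
  let y : ι → WeakDual ℂ (BDual E) := fun i =>
    StrongDual.toWeakDual (NormedSpace.inclusionInDoubleDual ℂ E (x i))
  have hK := WeakDual.isCompact_closedBall (𝕜 := ℂ) (0 : BDual (BDual E)) C
  obtain ⟨p, hp, hle⟩ := isCompact_iff_ultrafilter_le_nhds.1 hK (U.map y) (by
    rw [le_principal_iff, Ultrafilter.mem_coe, Ultrafilter.mem_map]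
    refine Filter.univ_mem' fun i => ?_
    have h1 := (NormedSpace.double_dual_bound ℂ E (x i)).trans (hx i)
    simpa [y] using h1)
  refine ⟨WeakDual.toStrongDual p, by simpa using hp, fun f => ?_⟩
  exact ((WeakDual.eval_continuous f).tendsto p).comp hle

end Functionals

/-! ### The singular part of the bidual and asymptotic `ℓ¹`-sequences -/

/-- The canonical embedding of `E` into `E''`. -/
noncomputable def toBidual (E : Type u) [NormedAddCommGroup E] [NormedSpace ℂ E] :
    E →L[ℂ] BDual (BDual E) :=
  NormedSpace.inclusionInDoubleDual ℂ E

section Singular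

variable {X : Type u} [NormedAddCommGroup X] [NormedSpace ℂ X]

@[simp]
theorem toBidual_apply (x : X) (f : BDual X) : toBidual X x f = f x := rfl

@[simp]
theorem norm_toBidual (x : X) : ‖toBidual X x‖ = ‖x‖ :=
  (NormedSpace.inclusionInDoubleDualLi ℂ).norm_map x

/-- `S` is the complement of `X` in an `ℓ¹`-decomposition `X'' = X ⊕₁ S`. -/
structure IsSingularPart (S : Submodule ℂ (BDual (BDual X))) : Prop where
  norm_add : ∀ x : X, ∀ s ∈ S, ‖toBidual X x + s‖ = ‖x‖ + ‖s‖
  exists_eq : ∀ p : BDual (BDual X), ∃ x : X, ∃ s ∈ S, p = toBidual X x + s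

theorem IsSingularPart.eq_zero_of_mem {S : Submodule ℂ (BDual (BDual X))}
    (hS : IsSingularPart S) {x : X} (hx : toBidual X x ∈ S) : x = 0 := by
  have h := hS.norm_add x _ (S.neg_mem hx)
  rw [add_neg_cancel, norm_zero, norm_neg, norm_toBidual] at h
  exact norm_eq_zero.1 (by linarith [norm_nonneg x])

theorem LEmbedded.exists_isSingularPart (hX : LEmbedded X) :
    ∃ S : Submodule ℂ (BDual (BDual X)), IsSingularPart S := by
  obtain ⟨P, hP, hr⟩ := hX
  have hPP : ∀ p, P (P p) = P p := fun p => DFunLike.congr_fun hP.proj.eq p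
  have hPJ : ∀ x, P (toBidual X x) = toBidual X x := by
    intro x
    have : toBidual X x ∈ P.range := hr ▸ ⟨x, rfl⟩
    obtain ⟨q, hq⟩ := this
    have hq' : P q = toBidual X x := hq
    rw [← hq', hPP]
  refine ⟨P.ker, ⟨fun x s hs => ?_, fun p => ?_⟩⟩
  · have hs' : P s = 0 := hs
    have h := hP.Lnorm (toBidual X x + s)
    simpa [sub_smul, hPJ, hs'] using h
  · have : P p ∈ canonicalImage X := hr ▸ ⟨p, rfl⟩
    obtain ⟨x, hx⟩ := this
    have hx' : toBidual X x = P p := hx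
    refine ⟨x, p - P p, ?_, by rw [hx']; abel⟩
    change P (p - P p) = 0
    rw [map_sub, hPP, sub_self]

/-- A sequence satisfying the asymptotic lower `ℓ¹`-estimate admits functionals with prescribed
values. -/
theorem exists_dual_apply_eq {v : ℕ → X} {r : ℕ → ℝ}
    (hlow : ∀ (s : Finset ℕ) (α : ℕ → ℂ), ∑ n ∈ s, r n * ‖α n‖ ≤ ‖∑ n ∈ s, α n • v n‖)
    {c : ℕ → ℂ} (hc : ∀ n, ‖c n‖ ≤ r n) : ∃ f : BDual X, ‖f‖ ≤ 1 ∧ ∀ n, f (v n) = c n := by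
  obtain ⟨f, hf, h⟩ := exists_dual_of_norm_le (Finsupp.linearCombination ℂ v)
    (Finsupp.linearCombination ℂ c) fun a => by
      rw [Finsupp.linearCombination_apply, Finsupp.linearCombination_apply]
      refine le_trans ?_ (hlow a.support a)
      refine (norm_sum_le _ _).trans (Finset.sum_le_sum fun n _ => ?_)
      rw [norm_smul, mul_comm]
      gcongr
      exact hc n
  exact ⟨f, hf, fun n => by simpa using h (Finsupp.single n 1)⟩

/-- Test on a functional of norm at most 1 equal to r n off F and to -r n times the conjugate phase
of α n on F: p sees only the tail, giving 1, while the finite sum contributes with the right sign.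
-/
theorem one_add_sum_le_norm_sub {v : ℕ → X} {r : ℕ → ℝ} (hr0 : ∀ n, 0 ≤ r n)
    (hr : Tendsto r atTop (𝓝 1))
    (hlow : ∀ (s : Finset ℕ) (α : ℕ → ℂ), ∑ n ∈ s, r n * ‖α n‖ ≤ ‖∑ n ∈ s, α n • v n‖)
    {U : Ultrafilter ℕ} (hU : (U : Filter ℕ) ≤ atTop) {p : BDual (BDual X)}
    (hp : ∀ f : BDual X, Tendsto (fun n => f (v n)) U (𝓝 (p f)))
    (F : Finset ℕ) (α : ℕ → ℂ) :
    1 + ∑ n ∈ F, r n * ‖α n‖ ≤ ‖p - toBidual X (∑ n ∈ F, α n • v n)‖ := by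
  classical
  choose w hw hwα using fun n => RCLike.exists_norm_eq_mul_self (α n)
  obtain ⟨f, hf, hfv⟩ := exists_dual_apply_eq hlow
    (c := fun n => if n ∈ F then -(r n * w n) else r n) fun n => by
      split_ifs <;> simp [hw, abs_of_nonneg (hr0 n)]
  have hpf : p f = 1 := by
    refine tendsto_nhds_unique (hp f) ?_
    have h1 : Tendsto (fun n => (r n : ℂ)) U (𝓝 ((1 : ℝ) : ℂ)) :=
      (Complex.continuous_ofReal.tendsto 1).comp (hr.mono_left hU)
    rw [Complex.ofReal_one] at h1
    refine h1.congr' (hU ?_)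
    filter_upwards [eventually_gt_atTop (F.sup id)] with n hn
    have : n ∉ F := fun h => absurd (Finset.le_sup (f := id) h) (not_le.2 hn)
    simp [hfv, this]
  have hval : (p - toBidual X (∑ n ∈ F, α n • v n)) f =
      ((1 + ∑ n ∈ F, r n * ‖α n‖ : ℝ) : ℂ) := by
    rw [sub_apply, hpf, toBidual_apply, map_sum]
    push_cast
    rw [sub_eq_add_neg, ← Finset.sum_neg_distrib]
    congr 1
    refine Finset.sum_congr rfl fun n hn => ?_
    have := hwα n
    simp only [map_smul, hfv, hn, if_true, smul_eq_mul]
    rw [show ((‖α n‖ : ℝ) : ℂ) = w n * α n from this]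
    ring
  have hnn : 0 ≤ 1 + ∑ n ∈ F, r n * ‖α n‖ := by
    have := Finset.sum_nonneg fun n (_ : n ∈ F) => mul_nonneg (hr0 n) (norm_nonneg (α n))
    linarith
  have := (p - toBidual X (∑ n ∈ F, α n • v n)).unit_le_opNorm f hf
  rwa [hval, Complex.norm_real, Real.norm_of_nonneg hnn] at this

/-- Weak* limits of normalized asymptotic `ℓ¹`-sequences are singular. -/
theorem IsSingularPart.limit_mem {S : Submodule ℂ (BDual (BDual X))} (hS : IsSingularPart S)
    {v : ℕ → X} {r : ℕ → ℝ} (hr0 : ∀ n, 0 ≤ r n) (hr : Tendsto r atTop (𝓝 1))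
    (hv : ∀ n, ‖v n‖ ≤ 1)
    (hlow : ∀ (s : Finset ℕ) (α : ℕ → ℂ), ∑ n ∈ s, r n * ‖α n‖ ≤ ‖∑ n ∈ s, α n • v n‖)
    {U : Ultrafilter ℕ} (hU : (U : Filter ℕ) ≤ atTop) {p : BDual (BDual X)}
    (hp : ∀ f : BDual X, Tendsto (fun n => f (v n)) U (𝓝 (p f))) : p ∈ S := by
  obtain ⟨y, s, hs, rfl⟩ := hS.exists_eq p
  have hp1 : ‖y‖ + ‖s‖ ≤ 1 := by
    rw [← hS.norm_add y s hs]
    refine ContinuousLinearMap.opNorm_le_bound _ zero_le_one fun f => ?_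
    refine le_of_tendsto (hp f).norm (Eventually.of_forall fun n => ?_)
    rw [mul_comm]
    exact f.le_opNorm_of_le (hv n) |>.trans (le_refl _)
  -- Splitting the norm of (y - ∑) + s and using ‖s‖ ≤ 1 - ‖y‖ shows that y itself is ℓ¹-orthogonal
  -- to the sequence; `h2` is the homogeneous form.
  have h1 : ∀ (F : Finset ℕ) (α : ℕ → ℂ),
      ‖y‖ + ∑ n ∈ F, r n * ‖α n‖ ≤ ‖y - ∑ n ∈ F, α n • v n‖ := by
    intro F α
    have h := one_add_sum_le_norm_sub hr0 hr hlow hU hp F α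
    rw [add_sub_right_comm, ← map_sub, hS.norm_add _ s hs] at h
    linarith
  have h2 : ∀ (β : ℂ) (F : Finset ℕ) (α : ℕ → ℂ),
      ‖β‖ * ‖y‖ + ∑ n ∈ F, r n * ‖α n‖ ≤ ‖β • y + ∑ n ∈ F, α n • v n‖ := by
    intro β F α
    by_cases hβ : β = 0
    · simpa [hβ] using hlow F α
    · have h := mul_le_mul_of_nonneg_left (h1 F fun n => -(β⁻¹ * α n)) (norm_nonneg β)
      rw [← norm_smul, smul_sub, Finset.smul_sum, mul_add, Finset.mul_sum] at h
      refine le_of_eq_of_le ?_ (h.trans_eq (congrArg norm ?_))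
      · refine congrArg (‖β‖ * ‖y‖ + ·) (Finset.sum_congr rfl fun n _ => ?_)
        rw [norm_neg, norm_mul, norm_inv]
        field_simp [norm_ne_zero_iff.2 hβ]
      · rw [sub_eq_add_neg, ← Finset.sum_neg_distrib]
        refine congrArg (β • y + ·) (Finset.sum_congr rfl fun n _ => ?_)
        rw [smul_smul, ← neg_smul, mul_neg, neg_neg, mul_inv_cancel_left₀ hβ]
  -- The value at y can therefore be chosen opposite in sign to the limit 1 along the sequence. Then
  -- s f = 1 + ‖y‖, so ‖s‖ ≥ 1 + ‖y‖, which with ‖y‖ + ‖s‖ ≤ 1 forces y = 0.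
  obtain ⟨f, hf, hfv⟩ := exists_dual_of_norm_le
    ((LinearMap.toSpanSingleton ℂ X y).coprod (Finsupp.linearCombination ℂ v))
    ((LinearMap.toSpanSingleton ℂ ℂ (-(‖y‖ : ℂ))).coprod
      (Finsupp.linearCombination ℂ fun n => (r n : ℂ))) (by
    rintro ⟨β, a⟩
    simp only [LinearMap.coprod_apply, LinearMap.toSpanSingleton_apply,
      Finsupp.linearCombination_apply]
    refine le_trans ?_ (h2 β a.support a)
    refine (norm_add_le _ _).trans (add_le_add (by simp) ?_)
    refine (norm_sum_le _ _).trans (Finset.sum_le_sum fun n _ => ?_)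
    simp [abs_of_nonneg (hr0 n), mul_comm])
  have hfy : f y = -(‖y‖ : ℂ) := by simpa using hfv (1, 0)
  have hfn : ∀ n, f (v n) = (r n : ℂ) := fun n => by simpa using hfv (0, Finsupp.single n 1)
  have hpf : (toBidual X y + s) f = 1 := by
    refine tendsto_nhds_unique (hp f) ?_
    simp only [hfn]
    rw [← Complex.ofReal_one]
    exact (Complex.continuous_ofReal.tendsto 1).comp (hr.mono_left hU)
  rw [add_apply, toBidual_apply, hfy] at hpf
  have hsf : s f = ((1 + ‖y‖ : ℝ) : ℂ) := by
    push_cast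
    linear_combination hpf
  have h3 := s.unit_le_opNorm f hf
  rw [hsf, Complex.norm_real, Real.norm_of_nonneg (by positivity)] at h3
  have hy : y = 0 := norm_eq_zero.1 (by linarith [norm_nonneg y])
  simpa [hy] using hs

end Singular

/-! ### The abstract measure topology -/

section MeasureTopology

variable {X : Type u} [NormedAddCommGroup X] [NormedSpace ℂ X]

theorem SpansL1Asymptotically.comp_strictMono {x : ℕ → X} (hx : SpansL1Asymptotically x)
    {φ : ℕ → ℕ} (hφ : StrictMono φ) : SpansL1Asymptotically (x ∘ φ) := by
  obtain ⟨hne, δ, hδ, hδ0, h⟩ := hx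
  refine ⟨fun n => hne _, δ ∘ φ, fun n => hδ _, hδ0.comp hφ.tendsto_atTop, fun s α => ?_⟩
  have := h (s.map ⟨φ, hφ.injective⟩) (Function.extend φ α 0)
  simp only [Finset.sum_map, Function.Embedding.coeFn_mk, hφ.injective.extend_apply] at this
  exact this

/-- The bounded sequences that span `ℓ¹` asymptotically or tend to `0` in norm. -/
def IsL1OrNormNull (y : ℕ → X) : Prop :=
  (∃ C : ℝ, ∀ n, ‖y n‖ ≤ C) ∧
    (SpansL1Asymptotically y ∨ Tendsto (fun n => ‖y n‖) atTop (𝓝 0))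

theorem IsL1OrNormNull.comp_strictMono {y : ℕ → X} (hy : IsL1OrNormNull y) {φ : ℕ → ℕ}
    (hφ : StrictMono φ) : IsL1OrNormNull (y ∘ φ) := by
  obtain ⟨⟨C, hC⟩, h⟩ := hy
  exact ⟨⟨C, fun n => hC _⟩, h.imp (fun h => h.comp_strictMono hφ)
    fun h => h.comp hφ.tendsto_atTop⟩

/-- In the ℓ¹ case the norms converge along U to some t, so p is t times the limit of the normalized
sequence. -/
theorem IsL1OrNormNull.limit_mem {y : ℕ → X} (hy : IsL1OrNormNull y)
    {S : Submodule ℂ (BDual (BDual X))} (hS : IsSingularPart S)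
    {U : Ultrafilter ℕ} (hU : (U : Filter ℕ) ≤ atTop) {p : BDual (BDual X)}
    (hp : ∀ f : BDual X, Tendsto (fun n => f (y n)) U (𝓝 (p f))) : p ∈ S := by
  obtain ⟨⟨C, hC⟩, ⟨hne, δ, hδ, hδ0, h⟩ | hnull⟩ := hy
  · have hv : ∀ n, ‖((‖y n‖⁻¹ : ℝ) : ℂ) • y n‖ ≤ 1 := fun n => by
      rw [norm_smul, Complex.norm_real, norm_inv, norm_norm,
        inv_mul_cancel₀ (norm_ne_zero_iff.2 (hne n))]
    obtain ⟨q, -, hq⟩ := exists_weakStar_limit U _ hv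
    have hqS : q ∈ S := hS.limit_mem (r := fun n => 1 - δ n) (fun n => by linarith [(hδ n).2])
      (by simpa using hδ0.const_sub 1) hv (fun s α => (h s α).1) hU hq
    obtain ⟨t, -, ht⟩ := isCompact_iff_ultrafilter_le_nhds.1 (isCompact_Icc (a := (0 : ℝ)) (b := C))
      (U.map fun n => ‖y n‖) (by
        rw [le_principal_iff, Ultrafilter.mem_coe, Ultrafilter.mem_map]
        exact Filter.univ_mem' fun n => ⟨norm_nonneg _, hC n⟩)
    have ht' : Tendsto (fun n => ((‖y n‖ : ℝ) : ℂ)) U (𝓝 (t : ℂ)) :=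
      (Complex.continuous_ofReal.tendsto t).comp ht
    have : p = (t : ℂ) • q := by
      ext f
      refine tendsto_nhds_unique (hp f) ((ht'.mul (hq f)).congr fun n => ?_)
      rw [map_smul, smul_eq_mul, Complex.ofReal_inv, mul_inv_cancel_left₀]
      exact Complex.ofReal_ne_zero.2 (norm_ne_zero_iff.2 (hne n))
    exact this ▸ S.smul_mem _ hqS
  · have : p = 0 := by
      ext f
      refine tendsto_nhds_unique (hp f) ?_
      have h0 := (f.continuous.tendsto 0).comp (tendsto_zero_iff_norm_tendsto_zero.2 hnull)
      rw [map_zero] at h0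
      exact h0.mono_left hU
    exact this ▸ S.zero_mem

theorem IsL1OrNormNull.tendsto_apply {y : ℕ → X} (hy : IsL1OrNormNull y)
    {S : Submodule ℂ (BDual (BDual X))} (hS : IsSingularPart S) {f : BDual X}
    (hf : ∀ s ∈ S, s f = 0) : Tendsto (fun n => f (y n)) atTop (𝓝 0) := by
  refine tendsto_iff_ultrafilter _ _ _ |>.2 fun U hU => ?_
  obtain ⟨C, hC⟩ := hy.1
  obtain ⟨p, -, hp⟩ := exists_weakStar_limit U y hC
  rw [← hf p (hy.limit_mem hS hU hp)]
  exact hp f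

/-- Convergence in measure: every subsequence of `x - a` has a further subsequence which is
bounded and spans `ℓ¹` asymptotically or tends to `0` in norm. -/
def MeasureConv (x : ℕ → X) (a : X) : Prop :=
  ∀ φ : ℕ → ℕ, StrictMono φ → ∃ ψ : ℕ → ℕ, StrictMono ψ ∧
    IsL1OrNormNull fun n => x (φ (ψ n)) - a

theorem measureConv_iff_sub {x : ℕ → X} {a : X} :
    MeasureConv x a ↔ MeasureConv (fun n => x n - a) 0 := by
  simp [MeasureConv]

theorem MeasureConv.comp_strictMono {x : ℕ → X} {a : X} (h : MeasureConv x a) {φ : ℕ → ℕ}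
    (hφ : StrictMono φ) : MeasureConv (x ∘ φ) a :=
  fun ξ hξ => h (φ ∘ ξ) (hφ.comp hξ)

theorem measureConv_of_tendsto {x : ℕ → X} {a : X} (h : Tendsto x atTop (𝓝 a)) :
    MeasureConv x a := by
  intro φ hφ
  have h1 : Tendsto (fun n => x (φ n) - a) atTop (𝓝 0) := by
    simpa using (h.comp hφ.tendsto_atTop).sub_const a
  obtain ⟨C, hC⟩ := (Metric.isBounded_range_of_tendsto _ h1).exists_norm_le
  exact ⟨id, strictMono_id, ⟨C, fun n => hC _ ⟨n, rfl⟩⟩,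
    Or.inr (tendsto_zero_iff_norm_tendsto_zero.1 h1)⟩

theorem IsL1OrNormNull.measureConv {y : ℕ → X} (h : IsL1OrNormNull y) : MeasureConv y 0 := by
  intro φ hφ
  refine ⟨id, strictMono_id, ?_⟩
  simpa [Function.comp_def] using h.comp_strictMono hφ

theorem MeasureConv.exists_bound {y : ℕ → X} (h : MeasureConv y 0) :
    ∃ C : ℝ, ∀ n, ‖y n‖ ≤ C := by
  by_contra! hno
  have hfreq : ∀ m : ℕ, ∃ᶠ n in atTop, (m : ℝ) < ‖y n‖ := by
    intro m
    rw [frequently_atTop]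
    by_contra! hN
    obtain ⟨N, hN⟩ := hN
    -- Adding the sum of the first N norms excludes indices below N.
    obtain ⟨n, hn⟩ := hno (m + ∑ k ∈ Finset.range N, ‖y k‖)
    rcases lt_or_ge n N with h | h
    · have := Finset.single_le_sum (f := fun k => ‖y k‖) (fun k _ => norm_nonneg _)
        (Finset.mem_range.2 h)
      have hm : (0 : ℝ) ≤ m := m.cast_nonneg
      linarith
    · have := hN n h
      have h0 := Finset.sum_nonneg fun k (_ : k ∈ Finset.range N) => norm_nonneg (y k)
      linarith
  obtain ⟨φ, hφ, hφy⟩ := extraction_forall_of_frequently hfreq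
  obtain ⟨ψ, hψ, ⟨C, hC⟩, -⟩ := h φ hφ
  obtain ⟨m, hm⟩ := exists_nat_gt C
  have h1 := hφy (ψ m)
  have h2 := hC m
  simp only [sub_zero] at h2
  have h3 : (m : ℝ) ≤ ψ m := by exact_mod_cast hψ.le_apply
  linarith

/-- This carries convergence in measure over to the bidual: weak* limits of a suitable subsequence
lie in a + S. -/
theorem MeasureConv.exists_limit {x : ℕ → X} {a : X} (h : MeasureConv x a)
    {S : Submodule ℂ (BDual (BDual X))} (hS : IsSingularPart S) :
    ∃ φ : ℕ → ℕ, StrictMono φ ∧ (∃ C : ℝ, ∀ n, ‖x (φ n)‖ ≤ C) ∧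
      ∀ (U : Ultrafilter ℕ), (U : Filter ℕ) ≤ atTop → ∀ p : BDual (BDual X),
      (∀ f : BDual X, Tendsto (fun n => f (x (φ n))) U (𝓝 (p f))) → p - toBidual X a ∈ S := by
  obtain ⟨φ, hφ, hy⟩ := h id strictMono_id
  refine ⟨φ, hφ, ?_, fun U hU p hp => hy.limit_mem hS hU fun f => ?_⟩
  · obtain ⟨C, hC⟩ := hy.1
    refine ⟨C + ‖a‖, fun n => ?_⟩
    have := norm_le_norm_sub_add (x (φ n)) a
    have := hC n
    simp only [id] at this
    linarith
  · simpa using (hp f).sub_const (f a)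

theorem isSeqConvergence_measureConv {S : Submodule ℂ (BDual (BDual X))}
    (hS : IsSingularPart S) : IsSeqConvergence (MeasureConv (X := X)) where
  const a := measureConv_of_tendsto tendsto_const_nhds
  subseq h hφ := h.comp_strictMono hφ
  urysohn {x a} h φ hφ := by
    obtain ⟨ψ, hψ, h1⟩ := h φ hφ
    obtain ⟨ξ, hξ, h2⟩ := h1 id strictMono_id
    exact ⟨ψ ∘ ξ, hψ.comp hξ, h2⟩
  unique {x a b} ha hb := by
    obtain ⟨φ, hφ, ⟨C, hC⟩, h1⟩ := ha.exists_limit hS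
    obtain ⟨ψ, hψ, -, h2⟩ := (hb.comp_strictMono hφ).exists_limit hS
    obtain ⟨U, hU⟩ : ∃ U : Ultrafilter ℕ, (U : Filter ℕ) ≤ atTop :=
      ⟨Ultrafilter.of atTop, Ultrafilter.of_le _⟩
    -- One weak* limit of a common subsequence serves both a and b, so a - b lies in X ∩ S = 0.
    obtain ⟨p, -, hp⟩ := exists_weakStar_limit U (fun n => x (φ (ψ n))) fun n => hC _
    have h3 := h1 (U.map ψ) (hψ.tendsto_atTop.mono_left hU) p fun f => tendsto_map'_iff.2 (hp f)
    have h4 := h2 U hU p hp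
    refine sub_eq_zero.1 (hS.eq_zero_of_mem (x := a - b) ?_)
    rw [map_sub]
    convert S.sub_mem h4 h3 using 1
    abel

/-- A weak* limit p = a + s satisfies ‖a‖ ≤ ‖a‖ + ‖s‖ = ‖p‖ ≤ C. Hence balls are closed in measure.
-/
theorem norm_le_of_measureConv {S : Submodule ℂ (BDual (BDual X))}
    (hS : IsSingularPart S) {x : ℕ → X} {a : X} {C : ℝ} (h : MeasureConv x a)
    (hx : ∀ n, ‖x n‖ ≤ C) : ‖a‖ ≤ C := by
  obtain ⟨φ, hφ, -, h1⟩ := h.exists_limit hS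
  obtain ⟨p, hpC, hp⟩ := exists_weakStar_limit (Ultrafilter.of atTop) (fun n => x (φ n))
    fun n => hx _
  have h2 := hS.norm_add a _ (h1 _ (Ultrafilter.of_le _) p hp)
  rw [add_sub_cancel] at h2
  linarith [norm_nonneg (p - toBidual X a)]

theorem IsSingularPart.isAbstractMeasureTopology {S : Submodule ℂ (BDual (BDual X))}
    (hS : IsSingularPart S) :
    IsAbstractMeasureTopology X (seqTopology (MeasureConv (X := X))) := by
  have hc := isSeqConvergence_measureConv hS
  refine ⟨sequentialSpace_seqTopology _ hc, fun x a b ha hb => ?_, fun U hU => ?_,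
    fun x a => ?_, fun x hb hx => ?_, fun x hx => ?_, fun x hx => ?_⟩
  · exact hc.unique (hc.tauTendsto_iff.1 ha) (hc.tauTendsto_iff.1 hb)
  · rw [← isClosed_compl_iff]
    refine IsSeqClosed.isClosed fun x a hx hxa ha => ?_
    obtain ⟨n, hn⟩ := (hU x a (measureConv_of_tendsto hxa) ha).exists
    exact hx n hn
  · rw [hc.tauTendsto_iff, hc.tauTendsto_iff]
    exact measureConv_iff_sub
  · exact hc.tauTendsto_iff.2 (IsL1OrNormNull.measureConv ⟨hb, Or.inl hx⟩)
  · exact (hc.tauTendsto_iff.1 hx).exists_bound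
  · obtain ⟨φ, hφ, -, h⟩ := hc.tauTendsto_iff.1 hx id strictMono_id
    refine ⟨φ, hφ, ?_⟩
    simpa [Function.comp_def] using h

theorem eventually_mem_of_tendsto_norm_sub {E : Type v} [NormedAddCommGroup E] {U : Set E}
    (hU : IsOpen U) {x : ℕ → E} {a : E}
    (ha : a ∈ U) (h : Tendsto (fun n => ‖x n - a‖) atTop (𝓝 0)) : ∀ᶠ n in atTop, x n ∈ U :=
  (tendsto_iff_norm_sub_tendsto_zero.2 h) (hU.mem_nhds ha)

theorem IsAbstractMeasureTopology.tauTendsto_of_tendsto {τ : TopologicalSpace X}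
    (hτ : IsAbstractMeasureTopology X τ) {x : ℕ → X} {a : X}
    (h : Tendsto (fun n => ‖x n - a‖) atTop (𝓝 0)) : TauTendsto τ x a :=
  tauTendsto_iff_isOpen.2 fun U hU ha =>
    eventually_mem_of_tendsto_norm_sub (hτ.weaker U hU) ha h

/-- After translation, the axioms on null sequences say this up to subsequences, and topological
convergence can be tested on subsequences. The right-hand side does not involve τ, whence
uniqueness. -/
theorem IsAbstractMeasureTopology.tauTendsto_iff {τ : TopologicalSpace X}
    (hτ : IsAbstractMeasureTopology X τ) {x : ℕ → X} {a : X} :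
    TauTendsto τ x a ↔ MeasureConv x a := by
  rw [hτ.translation, measureConv_iff_sub]
  generalize (fun n => x n - a) = y
  refine ⟨fun h φ hφ => ?_, fun h => ?_⟩
  · obtain ⟨C, hC⟩ := hτ.bounded_of_null y h
    obtain ⟨ψ, hψ, h1⟩ := hτ.subseq_of_null _ (h.comp_strictMono hφ)
    refine ⟨ψ, hψ, ⟨C, fun n => by simpa using hC _⟩, ?_⟩
    simpa [Function.comp_def] using h1
  · rw [tauTendsto_iff_isOpen]
    intro U hU h0
    by_contra hne
    obtain ⟨φ, hφ, hx⟩ := extraction_of_frequently_atTop (not_eventually.1 hne)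
    obtain ⟨ψ, hψ, hb, h1⟩ := h φ hφ
    simp only [sub_zero] at hb h1
    have h2 : TauTendsto τ (fun n => y (φ (ψ n))) 0 := by
      rcases h1 with h1 | h1
      · exact hτ.null_of_spans _ hb h1
      · exact hτ.tauTendsto_of_tendsto (by simpa using h1)
    obtain ⟨n, hn⟩ := (tauTendsto_iff_isOpen.1 h2 U hU h0).exists
    exact hx _ hn

theorem IsSingularPart.existsUnique_isAbstractMeasureTopology
    {S : Submodule ℂ (BDual (BDual X))} (hS : IsSingularPart S) :
    ∃! τ : TopologicalSpace X, IsAbstractMeasureTopology X τ :=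
  ⟨_, hS.isAbstractMeasureTopology, fun _ hτ =>
    eq_of_tauTendsto_iff hτ.sequential hS.isAbstractMeasureTopology.sequential fun _ _ =>
      hτ.tauTendsto_iff.trans hS.isAbstractMeasureTopology.tauTendsto_iff.symm⟩

/-- Functionals vanishing on the singular part are continuous in measure on the unit ball. -/
theorem IsAbstractMeasureTopology.mem_sharpSpace_of_forall_eq_zero {τ : TopologicalSpace X}
    (hτ : IsAbstractMeasureTopology X τ) {S : Submodule ℂ (BDual (BDual X))}
    (hS : IsSingularPart S) {f : BDual X} (hf : ∀ s ∈ S, s f = 0) : f ∈ sharpSpace X τ := by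
  have := hτ.sequential
  change @ContinuousOn X ℂ τ _ (fun x => f x) (Metric.closedBall (0 : X) 1)
  refine (@continuousOn_iff_isClosed X ℂ τ _ _ _).2 fun t ht =>
    ⟨(fun x => f x) ⁻¹' t ∩ Metric.closedBall 0 1, ?_, by rw [Set.inter_assoc, Set.inter_self]⟩
  refine @IsSeqClosed.isClosed X τ this _ fun x a hx hxa => ?_
  have hconv : MeasureConv x a := hτ.tauTendsto_iff.1 hxa
  refine ⟨ht.mem_of_tendsto (?_ : Tendsto (fun n => f (x n)) atTop (𝓝 (f a)))
    (Eventually.of_forall fun n => (hx n).1), ?_⟩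
  · have h0 : Tendsto (fun n => f (x n) - f a) atTop (𝓝 0) := by
      refine tendsto_of_subseq_tendsto fun ns hns => ?_
      obtain ⟨θ, hθ, hmono⟩ := strictMono_subseq_of_tendsto_atTop hns
      obtain ⟨ψ, -, h⟩ := hconv _ hmono
      exact ⟨θ ∘ ψ, by simpa using h.tendsto_apply hS hf⟩
    simpa using h0.add_const (f a)
  · rw [mem_closedBall_zero_iff]
    exact norm_le_of_measureConv hS hconv fun n => mem_closedBall_zero_iff.1 (hx n).2

end MeasureTopology

/-! ### Singular elements are limits of asymptotic `ℓ¹`-sequences -/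

section Construction

variable {X : Type u} [NormedAddCommGroup X] [NormedSpace ℂ X]

/-- A singular element can be replaced, up to `ε`, by an element of `X` in a finite-dimensional
`ℓ¹`-sum. -/
theorem IsSingularPart.exists_almost_l1_extension {S : Submodule ℂ (BDual (BDual X))}
    (hS : IsSingularPart S) {s : BDual (BDual X)} (hs : s ∈ S) (hs1 : ‖s‖ = 1) (f : BDual X)
    (F : Submodule ℂ X) [FiniteDimensional ℂ F] {ε : ℝ} (hε : 0 < ε) :
    ∃ x : X, ‖x‖ ≤ 1 ∧ ‖f x - s f‖ < ε ∧
      ∀ v ∈ F, ∀ β : ℂ, (1 - ε) * (‖v‖ + ‖β‖) ≤ ‖v + β • x‖ := by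
  classical
  have : ProperSpace F := FiniteDimensional.proper_rclike ℂ F
  -- The unit sphere of F ⊕₁ ℂ. At each of its points v + β s has norm 1 and is nearly normed by
  -- some g in the ball of X'; by compactness finitely many g suffice, and Goldstine's theorem gives
  -- x close to s on these and on f.
  let K : Set (F × ℂ) := {q | ‖q.1‖ + ‖q.2‖ = 1}
  have hK : IsCompact K := by
    refine Metric.isCompact_of_isClosed_isBounded
      (isClosed_eq (by fun_prop) continuous_const) ?_
    refine (Metric.isBounded_closedBall (x := (0 : F × ℂ)) (r := 1)).subset fun q hq => ?_
    have hq : ‖q.1‖ + ‖q.2‖ = 1 := hq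
    rw [mem_closedBall_zero_iff, Prod.norm_def]
    exact max_le (by linarith [norm_nonneg q.2]) (by linarith [norm_nonneg q.1])
  let V : {g : BDual X // ‖g‖ ≤ 1} → Set (F × ℂ) := fun g =>
    {q | 1 - ε / 2 < ‖g.1 q.1 + q.2 * s g.1‖}
  obtain ⟨t, ht⟩ := hK.elim_finite_subcover V
    (fun g => isOpen_lt continuous_const (by fun_prop)) fun q hq => by
      have hq : ‖(q.1 : X)‖ + ‖q.2‖ = 1 := hq
      have h1 := hS.norm_add (q.1 : X) _ (S.smul_mem q.2 hs)
      rw [norm_smul, hs1, mul_one, hq] at h1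
      obtain ⟨g, hg, hgq⟩ := ContinuousLinearMap.exists_lt_apply_of_lt_opNorm
        (toBidual X (q.1 : X) + q.2 • s) (r := 1 - ε / 2) (by rw [h1]; linarith)
      exact Set.mem_iUnion.2 ⟨⟨g, hg.le⟩, by simpa [V] using hgq⟩
  obtain ⟨x, hx, hxg⟩ := exists_norm_le_one_forall_norm_sub_lt s hs1.le
    (insert f (t.image Subtype.val)) (half_pos hε)
  refine ⟨x, hx, (hxg f (Finset.mem_insert_self _ _)).trans (half_lt_self hε), ?_⟩
  have hunit : ∀ v ∈ F, ∀ β : ℂ, ‖v‖ + ‖β‖ = 1 → 1 - ε ≤ ‖v + β • x‖ := by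
    intro v hv β h1
    obtain ⟨g, hgt, hg⟩ := Set.mem_iUnion₂.1 (ht (show (⟨v, hv⟩, β) ∈ K from h1))
    have hg : 1 - ε / 2 < ‖g.1 v + β * s g.1‖ := hg
    have h2 := hxg g.1 (Finset.mem_insert_of_mem (Finset.mem_image_of_mem _ hgt))
    have h3 : ‖g.1 (v + β • x)‖ ≤ ‖v + β • x‖ :=
      (g.1.le_opNorm _).trans (mul_le_of_le_one_left (norm_nonneg _) g.2)
    have h4 : g.1 v + β * s g.1 = g.1 (v + β • x) - β * (g.1 x - s g.1) := by
      simp only [map_add, map_smul, smul_eq_mul]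
      ring
    have h5 : ‖β * (g.1 x - s g.1)‖ ≤ ε / 2 := by
      rw [norm_mul]
      exact (mul_le_of_le_one_left (norm_nonneg _) (by linarith [norm_nonneg v])).trans h2.le
    have h6 := norm_sub_le (g.1 (v + β • x)) (β * (g.1 x - s g.1))
    rw [← h4] at h6
    linarith
  intro v hv β
  rcases (add_nonneg (norm_nonneg v) (norm_nonneg β)).eq_or_lt with h0 | h0
  · rw [← h0, mul_zero]
    exact norm_nonneg _
  · set t := ‖v‖ + ‖β‖ with ht
    have hn : ‖((t⁻¹ : ℝ) : ℂ)‖ = t⁻¹ := by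
      rw [Complex.norm_real, Real.norm_of_nonneg (inv_nonneg.2 h0.le)]
    have h1 := hunit (((t⁻¹ : ℝ) : ℂ) • v) (F.smul_mem _ hv) (((t⁻¹ : ℝ) : ℂ) * β) (by
      rw [norm_smul, norm_mul, hn, ← mul_add, ← ht, inv_mul_cancel₀ h0.ne'])
    rw [mul_smul, ← smul_add, norm_smul, hn] at h1
    have h2 := mul_le_mul_of_nonneg_left h1 h0.le
    rwa [mul_inv_cancel_left₀ h0.ne', mul_comm] at h2

/-- Sequences built by successive almost `ℓ¹`-extensions satisfy a lower `ℓ¹`-estimate. -/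
theorem sum_range_le_of_step {r : ℕ → ℝ} {x : ℕ → X}
    (h : ∀ n (v : X), v ∈ Submodule.span ℂ (x '' Set.Iio n) → ∀ β : ℂ,
      r n * (‖v‖ + ‖β‖) ≤ r (n + 1) * ‖v + β • x n‖) (n : ℕ) (α : ℕ → ℂ) :
    ∑ i ∈ Finset.range n, r i * ‖α i‖ ≤ r n * ‖∑ i ∈ Finset.range n, α i • x i‖ := by
  induction n with
  | zero => simp
  | succ n ih =>
    rw [Finset.sum_range_succ, Finset.sum_range_succ]
    refine le_trans ?_ (h n _ (Submodule.sum_mem _ fun i hi => ?_) (α n))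
    · rw [mul_add]
      gcongr
    · exact Submodule.smul_mem _ _
        (Submodule.subset_span ⟨i, Finset.mem_range.1 hi, rfl⟩)

/-- Padding with zero coefficients passes from initial segments to finite sets, and normalizing
vectors of norm at most 1 only improves the lower estimate. -/
theorem spansL1Asymptotically_of_range {r : ℕ → ℝ} {x : ℕ → X} (hr0 : ∀ n, 0 < r n)
    (hr1 : ∀ n, r n ≤ 1) (hr : Tendsto r atTop (𝓝 1)) (hx : ∀ n, ‖x n‖ ≤ 1)
    (h : ∀ n (α : ℕ → ℂ),
      ∑ i ∈ Finset.range n, r i * ‖α i‖ ≤ ‖∑ i ∈ Finset.range n, α i • x i‖) :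
    SpansL1Asymptotically x := by
  classical
  have hs : ∀ (s : Finset ℕ) (α : ℕ → ℂ),
      ∑ i ∈ s, r i * ‖α i‖ ≤ ‖∑ i ∈ s, α i • x i‖ := by
    intro s α
    obtain ⟨n, hn⟩ := s.exists_nat_subset_range
    have := h n fun i => if i ∈ s then α i else 0
    simpa [apply_ite, ite_smul, Finset.sum_ite_mem, Finset.inter_eq_right.2 hn] using this
  have hne : ∀ n, x n ≠ 0 := by
    intro n hn
    have := hs {n} 1
    simp [hn] at this
    exact absurd this (not_le.2 (hr0 n))
  refine ⟨hne, fun n => 1 - r n, fun n => ⟨by linarith [hr1 n], by linarith [hr0 n]⟩,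
    by simpa using hr.const_sub 1, fun s α => ⟨?_, ?_⟩⟩
  · simp only [smul_smul]
    refine le_trans (Finset.sum_le_sum fun n _ => ?_) (hs s _)
    rw [sub_sub_cancel, norm_mul, Complex.norm_real, norm_inv, norm_norm]
    refine mul_le_mul_of_nonneg_left ?_ (hr0 n).le
    exact le_mul_of_one_le_right (norm_nonneg _)
      ((one_le_inv₀ (norm_pos_iff.2 (hne n))).2 (hx n))
  · refine (norm_sum_le _ _).trans (Finset.sum_le_sum fun n _ => ?_)
    rw [norm_smul, norm_smul, Complex.norm_real, norm_inv, norm_norm,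
      inv_mul_cancel₀ (norm_ne_zero_iff.2 (hne n)), mul_one]

theorem IsSingularPart.exists_spansL1Asymptotically {S : Submodule ℂ (BDual (BDual X))}
    (hS : IsSingularPart S) {s : BDual (BDual X)} (hs : s ∈ S) (hs1 : ‖s‖ = 1) {f : BDual X}
    {c : ℝ} (hc : c < ‖s f‖) :
    ∃ x : ℕ → X, (∀ n, ‖x n‖ ≤ 1) ∧ (∀ n, c ≤ ‖f (x n)‖) ∧ SpansL1Asymptotically x := by
  classical
  -- Any positive sequence increasing strictly to 1 would do: the n-th extension may lose the factor
  -- r n / r (n + 1), and these losses telescope.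
  let r : ℕ → ℝ := fun n => 1 - 1 / (n + 2)
  have hmono : ∀ n, r n < r (n + 1) := by
    intro n
    refine sub_lt_sub_left (one_div_lt_one_div_of_lt (by positivity) ?_) 1
    push_cast
    linarith
  have hr0 : ∀ n, 0 < r n := by
    intro n
    refine sub_pos.2 ((div_lt_one (by positivity)).2 ?_)
    have : (0 : ℝ) ≤ n := n.cast_nonneg
    linarith
  have hr1 : ∀ n, r n ≤ 1 := fun n => sub_le_self 1 (by positivity)
  have hr : Tendsto r atTop (𝓝 1) := by
    have h1 : Tendsto (fun n : ℕ => (1 : ℝ) / (n + 2)) atTop (𝓝 0) :=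
      tendsto_const_nhds.div_atTop (tendsto_atTop_add_const_right _ _ tendsto_natCast_atTop_atTop)
    simpa [r] using h1.const_sub 1
  have step : ∀ (n : ℕ) (T : Finset X), ∃ x : X, ‖x‖ ≤ 1 ∧ c ≤ ‖f x‖ ∧
      ∀ v ∈ Submodule.span ℂ (T : Set X), ∀ β : ℂ,
        r n * (‖v‖ + ‖β‖) ≤ r (n + 1) * ‖v + β • x‖ := by
    intro n T
    have h1 : 0 < 1 - r n / r (n + 1) := sub_pos.2 ((div_lt_one (hr0 _)).2 (hmono n))
    obtain ⟨x, hx, hfx, hl⟩ := hS.exists_almost_l1_extension hs hs1 f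
      (Submodule.span ℂ (T : Set X)) (lt_min h1 (sub_pos.2 hc))
    refine ⟨x, hx, ?_, fun v hv β => ?_⟩
    · have h2 := norm_sub_norm_le (s f) (f x)
      rw [norm_sub_rev] at h2
      have h3 := hfx.trans_le (min_le_right _ _)
      linarith
    · have h2 := hl v hv β
      have h3 : r n / r (n + 1) ≤ 1 - min (1 - r n / r (n + 1)) (‖s f‖ - c) := by
        linarith [min_le_left (1 - r n / r (n + 1)) (‖s f‖ - c)]
      have h4 := (mul_le_mul_of_nonneg_right h3
        (add_nonneg (norm_nonneg v) (norm_nonneg β))).trans h2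
      have h5 := mul_le_mul_of_nonneg_left h4 (hr0 (n + 1)).le
      rwa [← mul_assoc, mul_div_cancel₀ _ (hr0 (n + 1)).ne'] at h5
  choose g hg1 hgc hgl using step
  let T : ℕ → Finset X := fun n => Nat.rec ∅ (fun n T => insert (g n T) T) n
  have hT : ∀ n, T (n + 1) = insert (g n (T n)) (T n) := fun n => rfl
  have hmem : ∀ n i, i < n → g i (T i) ∈ T n := by
    intro n
    induction n with
    | zero => intro i hi; exact absurd hi (Nat.not_lt_zero i)
    | succ n ih =>
      intro i hi
      rw [hT]
      rcases Nat.lt_succ_iff_lt_or_eq.1 hi with h | rfl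
      · exact Finset.mem_insert_of_mem (ih i h)
      · exact Finset.mem_insert_self _ _
  have hsum := sum_range_le_of_step (r := r) (x := fun n => g n (T n)) fun n v hv β => by
    refine hgl n (T n) v (Submodule.span_mono ?_ hv) β
    rintro _ ⟨i, hi, rfl⟩
    exact hmem n i hi
  refine ⟨fun n => g n (T n), fun n => hg1 _ _, fun n => hgc _ _,
    spansL1Asymptotically_of_range hr0 hr1 hr (fun n => hg1 _ _) fun n α => ?_⟩
  exact (hsum n α).trans (mul_le_of_le_one_left (norm_nonneg _) (hr1 n))

/-- Functionals that are continuous in measure on the unit ball are those that vanish on the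
singular part. -/
theorem IsAbstractMeasureTopology.mem_sharpSpace_iff {τ : TopologicalSpace X}
    (hτ : IsAbstractMeasureTopology X τ) {S : Submodule ℂ (BDual (BDual X))}
    (hS : IsSingularPart S) {f : BDual X} : f ∈ sharpSpace X τ ↔ ∀ s ∈ S, s f = 0 := by
  refine ⟨fun hf => ?_, hτ.mem_sharpSpace_of_forall_eq_zero hS⟩
  have hunit : ∀ s ∈ S, ‖s‖ = 1 → s f = 0 := by
    intro s hs hs1
    by_contra hne
    have hpos : 0 < ‖s f‖ := norm_pos_iff.2 hne
    obtain ⟨x, hx1, hxc, hx⟩ := hS.exists_spansL1Asymptotically hs hs1 (half_lt_self hpos)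
    have h0 : TauTendsto τ x 0 := hτ.null_of_spans x ⟨1, hx1⟩ hx
    have hc : @ContinuousWithinAt X ℂ τ _ (fun x => f x) (Metric.closedBall (0 : X) 1) 0 :=
      hf 0 (by simp)
    have h1 : Tendsto (fun n => f (x n)) atTop (𝓝 (f 0)) :=
      Tendsto.comp hc (tendsto_inf.2 ⟨h0, tendsto_principal.2
        (Eventually.of_forall fun n => mem_closedBall_zero_iff.2 (hx1 n))⟩)
    have h2 := ge_of_tendsto h1.norm (Eventually.of_forall hxc)
    rw [map_zero, norm_zero] at h2
    linarith
  intro s hs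
  by_cases h0 : s = 0
  · simp [h0]
  · have h1 := hunit (((‖s‖⁻¹ : ℝ) : ℂ) • s) (S.smul_mem _ hs) (by
      rw [norm_smul, Complex.norm_real, norm_inv, norm_norm,
        inv_mul_cancel₀ (norm_ne_zero_iff.2 h0)])
    rw [smul_apply, smul_eq_mul] at h1
    refine (mul_eq_zero.1 h1).resolve_left ?_
    simpa using h0

end Construction

/-! ### Preduals -/

section Predual

variable {X : Type u} [NormedAddCommGroup X] [NormedSpace ℂ X]
  {Z : Type v} [NormedAddCommGroup Z] [NormedSpace ℂ Z]

/-- The transpose of an isometric isomorphism. -/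
noncomputable def dualCongr (e : X ≃ₗᵢ[ℂ] Z) : BDual Z ≃ₗᵢ[ℂ] BDual X where
  toFun φ := φ.comp (e.toContinuousLinearEquiv : X →L[ℂ] Z)
  invFun ψ := ψ.comp (e.symm.toContinuousLinearEquiv : Z →L[ℂ] X)
  map_add' _ _ := rfl
  map_smul' _ _ := rfl
  left_inv φ := by ext; simp
  right_inv ψ := by ext; simp
  norm_map' φ := φ.opNorm_comp_linearIsometryEquiv e

/-- A predual `Z` of `X`, regarded as a subspace of `X'`. -/
noncomputable def predualEmbedding (e : X ≃ₗᵢ[ℂ] BDual Z) : Z →ₗᵢ[ℂ] BDual X :=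
  (dualCongr e).toLinearIsometry.comp (NormedSpace.inclusionInDoubleDualLi ℂ)

@[simp]
theorem predualEmbedding_apply (e : X ≃ₗᵢ[ℂ] BDual Z) (z : Z) (x : X) :
    predualEmbedding e z x = e x z := rfl

/-- The annihilator in `X''` of a predual of `X`. -/
noncomputable def predualAnnihilator (e : X ≃ₗᵢ[ℂ] BDual Z) : Submodule ℂ (BDual (BDual X)) :=
  annihilatorInDual (LinearMap.range (predualEmbedding e).toLinearMap)

theorem mem_predualAnnihilator {e : X ≃ₗᵢ[ℂ] BDual Z} {p : BDual (BDual X)} :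
    p ∈ predualAnnihilator e ↔ ∀ z, p (predualEmbedding e z) = 0 :=
  ⟨fun h z => h _ ⟨z, rfl⟩, by rintro h _ ⟨z, rfl⟩; exact h z⟩

theorem mem_annihilator_canonicalImage {t : BDual (BDual (BDual Z))} :
    t ∈ annihilatorInDual (canonicalImage Z) ↔ ∀ z, t (toBidual Z z) = 0 :=
  ⟨fun h z => h _ ⟨z, rfl⟩, by rintro h _ ⟨z, rfl⟩; exact h z⟩

/-- `Z` is M-embedded iff `Z''' = Z' ⊕₁ Z^⊥` for the canonical decomposition. -/
theorem mEmbedded_iff_norm_add :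
    MEmbedded Z ↔ ∀ (φ : BDual Z), ∀ t ∈ annihilatorInDual (canonicalImage Z),
      ‖toBidual (BDual Z) φ + t‖ = ‖φ‖ + ‖t‖ := by
  constructor
  · rintro ⟨Q, hQ, hr⟩ φ t ht
    have hQQ : ∀ p, Q (Q p) = Q p := fun p => DFunLike.congr_fun hQ.proj.eq p
    have hQt : Q t = t := by
      rw [← hr] at ht
      obtain ⟨q, hq⟩ := ht
      have hq' : Q q = t := hq
      rw [← hq', hQQ]
    have hQφ : Q (toBidual (BDual Z) φ) = 0 := by
      have hmem : Q (toBidual (BDual Z) φ) ∈ annihilatorInDual (canonicalImage Z) :=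
        hr ▸ ⟨_, rfl⟩
      have h1 := hQ.Lnorm (toBidual (BDual Z) φ)
      simp only [sub_smul, one_smul, ContinuousLinearMap.smul_def, norm_toBidual] at h1
      -- Q φ vanishes on Z, so subtracting it does not change φ on Z and cannot lower the norm.
      have h2 : ‖φ‖ ≤ ‖toBidual (BDual Z) φ - Q (toBidual (BDual Z) φ)‖ := by
        refine φ.opNorm_le_bound (norm_nonneg _) fun z => ?_
        have h3 := (toBidual (BDual Z) φ - Q (toBidual (BDual Z) φ)).le_opNorm (toBidual Z z)
        rwa [sub_apply, mem_annihilator_canonicalImage.1 hmem z, sub_zero, toBidual_apply,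
          toBidual_apply, norm_toBidual] at h3
      exact norm_le_zero_iff.1 (by linarith)
    have h := hQ.Lnorm (toBidual (BDual Z) φ + t)
    simpa [sub_smul, hQt, hQφ, add_comm] using h
  · intro h
    let R : BDual (BDual (BDual Z)) →L[ℂ] BDual Z :=
      (ContinuousLinearMap.compL ℂ Z (BDual (BDual Z)) ℂ).flip (toBidual Z)
    have hR : ∀ q z, R q z = q (toBidual Z z) := fun _ _ => rfl
    let π := (toBidual (BDual Z)).comp R
    have hπ : ∀ q, π q = toBidual (BDual Z) (R q) := fun _ => rfl
    have hRR : ∀ φ, R (toBidual (BDual Z) φ) = φ := fun _ => rfl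
    have hmem : ∀ q, q - π q ∈ annihilatorInDual (canonicalImage Z) := fun q =>
      mem_annihilator_canonicalImage.2 fun z => by
        rw [sub_apply, hπ, toBidual_apply, toBidual_apply, hR, sub_self]
    refine ⟨1 - π, IsLprojection.Lcomplement ⟨?_, fun q => ?_⟩, ?_⟩
    · refine ContinuousLinearMap.ext fun q => ?_
      change π (π q) = π q
      rw [hπ, hπ, hRR]
    · have h1 := h (R q) _ (hmem q)
      rw [hπ, add_sub_cancel, ← hπ] at h1
      simpa [sub_smul, hπ] using h1
    · ext t
      refine ⟨?_, fun ht => ⟨t, ?_⟩⟩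
      · rintro ⟨q, rfl⟩
        exact hmem q
      · have : R t = 0 := by
          ext z
          rw [hR, mem_annihilator_canonicalImage.1 ht]
          rfl
        change t - π t = t
        rw [hπ, this, map_zero, sub_zero]

/-- The double transpose of e carries X to Z' and the annihilator of Z to Z^⊥. That the two parts
span X'' is automatic: restrict p to Z and pull back by e. -/
theorem mEmbedded_iff_isSingularPart (e : X ≃ₗᵢ[ℂ] BDual Z) :
    MEmbedded Z ↔ IsSingularPart (predualAnnihilator e) := by
  rw [mEmbedded_iff_norm_add]
  have hE : ∀ x s, dualCongr (dualCongr e) (toBidual X x + s) =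
      toBidual (BDual Z) (e x) + dualCongr (dualCongr e) s := fun x s => by
    rw [map_add]
    rfl
  have hmem : ∀ s, dualCongr (dualCongr e) s ∈ annihilatorInDual (canonicalImage Z) ↔
      s ∈ predualAnnihilator e := fun s => by
    rw [mem_annihilator_canonicalImage, mem_predualAnnihilator]
    rfl
  constructor
  · refine fun h => ⟨fun x s hs => ?_, fun p => ?_⟩
    · have h1 := h (e x) _ ((hmem s).2 hs)
      rwa [← hE, LinearIsometryEquiv.norm_map, LinearIsometryEquiv.norm_map,
        LinearIsometryEquiv.norm_map] at h1
    · let φ : BDual Z := p.comp (predualEmbedding e).toContinuousLinearMap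
      refine ⟨e.symm φ, p - toBidual X (e.symm φ), mem_predualAnnihilator.2 fun z => ?_, by abel⟩
      rw [sub_apply, toBidual_apply, predualEmbedding_apply, e.apply_symm_apply]
      exact sub_self _
  · intro h φ t ht
    obtain ⟨x, rfl⟩ := e.surjective φ
    obtain ⟨s, rfl⟩ := (dualCongr (dualCongr e)).surjective t
    rw [← hE, LinearIsometryEquiv.norm_map, LinearIsometryEquiv.norm_map,
      LinearIsometryEquiv.norm_map]
    exact h.norm_add x s ((hmem s).1 ht)

/-- With the annihilator of Z as singular part, X^# is the set of functionals killed by that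
annihilator. This is Z again by Hahn-Banach, since completeness makes Z closed in X'. -/
theorem IsAbstractMeasureTopology.range_predualEmbedding {τ : TopologicalSpace X}
    (hτ : IsAbstractMeasureTopology X τ) [CompleteSpace Z] (hZ : MEmbedded Z)
    (e : X ≃ₗᵢ[ℂ] BDual Z) :
    LinearMap.range (predualEmbedding e).toLinearMap = sharpSpace X τ := by
  ext f
  rw [hτ.mem_sharpSpace_iff ((mEmbedded_iff_isSingularPart e).1 hZ)]
  refine ⟨fun hf s hs => hs f hf, fun h => ?_⟩
  by_contra hf
  have hclosed : IsClosed (LinearMap.range (predualEmbedding e).toLinearMap : Set (BDual X)) :=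
    (predualEmbedding e).isometry.isClosedEmbedding.isClosed_range
  obtain ⟨p, hp, hpf⟩ := exists_dual_eq_zero_of_notMem hclosed hf
  exact hpf (h p hp)

theorem IsAbstractMeasureTopology.nonempty_linearIsometryEquiv_sharpSpace
    {τ : TopologicalSpace X} (hτ : IsAbstractMeasureTopology X τ) [CompleteSpace Z]
    (hZ : MEmbedded Z) (e : X ≃ₗᵢ[ℂ] BDual Z) : Nonempty (Z ≃ₗᵢ[ℂ] sharpSpace X τ) :=
  ⟨(predualEmbedding e).equivRange.trans
    (LinearIsometryEquiv.ofEq _ _ (hτ.range_predualEmbedding hZ e))⟩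

theorem IsAbstractMeasureTopology.isClosed_sharpSpace {τ : TopologicalSpace X}
    (hτ : IsAbstractMeasureTopology X τ) {S : Submodule ℂ (BDual (BDual X))}
    (hS : IsSingularPart S) : IsClosed (sharpSpace X τ : Set (BDual X)) := by
  have : (sharpSpace X τ : Set (BDual X)) = ⋂ s ∈ S, {f | s f = 0} := by
    ext f
    simpa using hτ.mem_sharpSpace_iff hS
  rw [this]
  exact isClosed_biInter fun s _ => isClosed_eq s.continuous continuous_const

/-- If a subspace `Y` of `X'` annihilated by the singular part separates the points of `X`, then
`X` is canonically the dual of `Y`. -/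
theorem IsSingularPart.exists_linearIsometryEquiv_dual {S : Submodule ℂ (BDual (BDual X))}
    (hS : IsSingularPart S) (Y : Submodule ℂ (BDual X)) (hY : ∀ f ∈ Y, ∀ s ∈ S, s f = 0)
    (hsep : ∀ x : X, (∀ f ∈ Y, f x = 0) → x = 0) :
    ∃ e : X ≃ₗᵢ[ℂ] BDual Y, ∀ x (f : Y), e x f = (f : BDual X) x := by
  have key : ∀ φ : BDual Y, ∃ x : X, (∀ f : Y, φ f = (f : BDual X) x) ∧ ‖x‖ ≤ ‖φ‖ := by
    intro φ
    -- The singular component of a norm-preserving extension is invisible on Y, and dropping it does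
    -- not increase the norm.
    obtain ⟨p, hp, hn⟩ := exists_extension_norm_eq Y φ
    obtain ⟨x, s, hs, rfl⟩ := hS.exists_eq p
    refine ⟨x, fun f => ?_, ?_⟩
    · rw [← hp f, add_apply, toBidual_apply, hY f f.2 s hs, add_zero]
    · rw [← hn, hS.norm_add x s hs]
      exact le_add_of_nonneg_right (norm_nonneg _)
  let L : X →ₗ[ℂ] BDual Y :=
    { toFun := fun x => (toBidual X x).comp Y.subtypeL
      map_add' := fun x y => by rw [map_add]; rfl
      map_smul' := fun c x => by rw [map_smul]; rfl }
  have hL : ∀ x (f : Y), L x f = (f : BDual X) x := fun _ _ => rfl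
  let I : X →ₗᵢ[ℂ] BDual Y :=
    { L with
      norm_map' := fun x => by
        refine le_antisymm ?_ ?_
        · refine (L x).opNorm_le_bound (norm_nonneg _) fun f => ?_
          rw [hL, mul_comm]
          exact (f : BDual X).le_opNorm x
        · obtain ⟨y, hy, hn⟩ := key (L x)
          have : x - y = 0 := hsep _ fun f hf => by
            rw [map_sub, ← hy ⟨f, hf⟩, hL, sub_self]
          rwa [← sub_eq_zero.1 this] at hn }
  refine ⟨LinearIsometryEquiv.ofSurjective I fun φ => ?_, fun x f => rfl⟩
  obtain ⟨x, hx, -⟩ := key φ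
  exact ⟨x, ContinuousLinearMap.ext fun f => (hx f).symm⟩

/-- The annihilator of X^# is exactly S: if x + s kills X^#, then so does x, and x = 0 by
separation. -/
theorem IsAbstractMeasureTopology.exists_predual {τ : TopologicalSpace X}
    (hτ : IsAbstractMeasureTopology X τ) {S : Submodule ℂ (BDual (BDual X))}
    (hS : IsSingularPart S)
    (hsep : ∀ x y : X, x ≠ y → ∃ f ∈ sharpSpace X τ, f x ≠ f y) :
    MEmbedded (sharpSpace X τ) ∧ Nonempty (X ≃ₗᵢ[ℂ] BDual (sharpSpace X τ)) := by
  have hsep0 : ∀ x : X, (∀ f ∈ sharpSpace X τ, f x = 0) → x = 0 := by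
    intro x hx
    by_contra hne
    obtain ⟨f, hf, hfx⟩ := hsep x 0 hne
    exact hfx (by rw [hx f hf, map_zero])
  obtain ⟨e, he⟩ := hS.exists_linearIsometryEquiv_dual (sharpSpace X τ)
    (fun f hf => (hτ.mem_sharpSpace_iff hS).1 hf) hsep0
  refine ⟨(mEmbedded_iff_isSingularPart e).2 ?_, ⟨e⟩⟩
  have hpe : ∀ f : sharpSpace X τ, predualEmbedding e f = f := fun f =>
    DFunLike.ext _ _ fun x => he x f
  suffices h : predualAnnihilator e = S from h.symm ▸ hS
  ext p
  rw [mem_predualAnnihilator]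
  simp only [hpe]
  refine ⟨fun hp => ?_, fun hp f => (hτ.mem_sharpSpace_iff hS).1 f.2 p hp⟩
  obtain ⟨x, s, hs, rfl⟩ := hS.exists_eq p
  have hx : x = 0 := hsep0 x fun f hf => by
    have h1 := hp ⟨f, hf⟩
    rwa [add_apply, (hτ.mem_sharpSpace_iff hS).1 hf s hs, add_zero, toBidual_apply] at h1
  rwa [hx, map_zero, zero_add]

end Predual

theorem mainTheorem4 (X : Type u) [NormedAddCommGroup X] [NormedSpace ℂ X]
    [CompleteSpace X] (hX : LEmbedded X) :
    (∃! τ : TopologicalSpace X, IsAbstractMeasureTopology X τ) ∧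
    ∀ τ : TopologicalSpace X, IsAbstractMeasureTopology X τ →
      ((∃ (Z : Type u) (_ : NormedAddCommGroup Z) (_ : NormedSpace ℂ Z),
          CompleteSpace Z ∧ MEmbedded Z ∧ Nonempty (X ≃ₗᵢ[ℂ] BDual Z)) ↔
        (∀ x y : X, x ≠ y → ∃ f ∈ sharpSpace X τ, f x ≠ f y)) ∧
      (∀ (Z : Type v) [NormedAddCommGroup Z] [NormedSpace ℂ Z] [CompleteSpace Z],
        MEmbedded Z → Nonempty (X ≃ₗᵢ[ℂ] BDual Z) →
          Nonempty (Z ≃ₗᵢ[ℂ] sharpSpace X τ)) := by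
  obtain ⟨S, hS⟩ := hX.exists_isSingularPart
  refine ⟨hS.existsUnique_isAbstractMeasureTopology, fun τ hτ => ⟨⟨?_, fun hsep => ?_⟩, ?_⟩⟩
  · rintro ⟨Z, _, _, _, hZ, ⟨e⟩⟩ x y hxy
    obtain ⟨z, hz⟩ : ∃ z, e x z ≠ e y z := by
      by_contra! h
      exact hxy (e.injective (ContinuousLinearMap.ext h))
    exact ⟨predualEmbedding e z, hτ.range_predualEmbedding hZ e ▸ ⟨z, rfl⟩, hz⟩
  · exact ⟨sharpSpace X τ, inferInstance, inferInstance,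
      (hτ.isClosed_sharpSpace hS).completeSpace_coe, hτ.exists_predual hS hsep⟩
  · rintro Z _ _ _ hZ ⟨e⟩
    exact hτ.nonempty_linearIsometryEquiv_sharpSpace hZ e
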